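/- Let $k$ be a field of characteristic $\neq 2$ and $n$ a positive integer. Let $C_n=\langle c\rangle$ be the cyclic group of order $n$ and let $H_4$ be Sweedler's Hopf algebra over $k$, with basis $1,g,x,gx$, relations $g^2=1$, $x^2=0$, $xg=-gx$, $g$ group-like and $\Delta(x)=x\otimes 1+g\otimes x$. Identify $C_2$ with the group $\{1,g\}$ of group-like elements of $H_4$, and call a map $u:C_n\to C_2$ unitary if $u(1)=1$. For a unitary map $t:C_n\to C_2$ put $\sigma_t(0)=\sigma_t(1)=0$ and, for $j\ge 2$, $\sigma_t(j)=\epsilon_j+\sum_{p=1}^{j-1}\mathrm{ord}\,t(c^p)$, where $\epsilon_j=1$ if $j$ is even and $\epsilon_j=0$ if $j$ is odd. Let $\mathcal{CS}(n,k)$ be the set of pairs $(t,\lambda)$ with $t:C_n\to C_2$ unitary, $\lambda\in k^*$ and $\lambda^n=(-1)^{\sigma_t(n)}$. For $(t,\lambda)\in\mathcal{CS}(n,k)$ let $H_{4n,\lambda,t}$ be the crossed product Hopf algebra $H_4\# k[C_n]$: as a coalgebra it is the tensor product $H_4\otimes k[C_n]$ (with $a\# h=a\otimes h$), its unit is $1\#1$,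 and its multiplication is $$(a\# c^i)(b\# c^j)=a\,(c^i\triangleright b)\,f_t(c^i,c^j)\# c^{i+j}\qquad(a,b\in H_4,\ 1\le i,j\le n),$$ where $c^i\triangleright 1=1$, $c^i\triangleright g=g$, $c^i\triangleright x=(-1)^{\sigma_t(i)}\lambda^i x$, $c^i\triangleright gx=(-1)^{\sigma_t(i)}\lambda^i gx$ and $f_t(c^i,c^j)=\prod_{p=0}^{i-1}t(c^p)\prod_{q=0}^{j-1}t(c^q)\prod_{r=0}^{i+j-1}t(c^r)$. For $\beta\in k^*$ let $u_\beta$ be the automorphism of $H_4$ with $u_\beta(g)=g$ and $u_\beta(x)=\beta x$. **Theorem.** Let $(t,\lambda),(t',\lambda')\in\mathcal{CS}(n,k)$. There is a bijection between the set of all triples $(\beta,r,s)$, where $\beta\in k^*$, $r:C_n\to C_2$ is unitary and $s\in\{1,\dots,n\}$ satisfies $\gcd(s,n)=1$ (so $s\le n-1$ if $n\ge 2$, and $s=1$ if $n=1$), such that for all $i,j=1,\dots,n$ $$\prod_{p=0}^{i-1}t(c^p)\,t(c^{p+j})=r(c^i)\,r(c^j)\,r(c^{i+j})\prod_{q=0}^{is-1}t'(c^q)\,t'(c^{q+js}),$$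 $$(-1)^{1+\sigma_t(i)+\mathrm{ord}\,r(c^i)}\,\lambda^i=(-1)^{\sigma_{t'}(is)}\,(\lambda')^{is},$$ and the set of all Hopf algebra isomorphisms $\psi:H_{4n,\lambda,t}\to H_{4n,\lambda',t'}$. Under this bijection the isomorphism $\psi=\psi_{(\beta,r,s)}$ corresponding to $(\beta,r,s)$ is given by $$\psi(a\# c^i)=u_\beta(a)\,r(c^i)\# c^{is}\qquad(a\in H_4,\ i=1,\dots,n).$$ -/

import Mathlib

open scoped TensorProduct

noncomputable section

namespace CrossedSweedler

/-! ### The cyclic groups -/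

/-- The cyclic group `C_n`, written multiplicatively. -/
abbrev Cyc (n : ℕ) : Type := Multiplicative (ZMod n)

/-- The generator `c` of `C_n`. -/
def gen (n : ℕ) : Cyc n := Multiplicative.ofAdd 1

/-- The exponent `i ∈ {0, …, n - 1}` of an element `h = c ^ i` of `C_n`. -/
def expo {n : ℕ} (h : Cyc n) : ℕ := (Multiplicative.toAdd h).val

/-- The function `σ_t : ℕ → ℕ` attached to a map `t : C_n → C_2`. -/
def sigma {n : ℕ} (t : Cyc n → Cyc 2) (j : ℕ) : ℕ :=
  if j ≤ 1 then 0
  else if Even j then 1 + ∑ p ∈ Finset.Icc 1 (j - 1), orderOf (t (gen n ^ p))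
  else ∑ p ∈ Finset.Icc 1 (j - 1), orderOf (t (gen n ^ p))

/-- The set `CS(n, k)`: pairs `(t, λ)` of a unitary map `t : C_n → C_2` and `λ ∈ k*` such that
`λ ^ n = (-1) ^ σ_t(n)`. -/
structure CS (k : Type*) [Field k] (n : ℕ) where
  /-- the map `t : C_n → C_2` -/
  t : Cyc n → Cyc 2
  t_one : t 1 = 1
  /-- the scalar `λ` -/
  lam : kˣ
  lam_pow : lam ^ n = (-1) ^ sigma t n

/-! ### Sweedler's four-dimensional Hopf algebra `H_4` -/

section Sweedler

variable (k : Type*) [Field k]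

/-- Sweedler's algebra `k⟨g, x | g² = 1, x² = 0, x g = - g x⟩`. It is the generalized quaternion
algebra with basis `1, g = i, x = j, gx = ij` and `i² = 1`, `j² = 0`, `j i = - i j`. -/
abbrev Sweedler : Type _ := QuaternionAlgebra k 1 0 0

namespace Sweedler

/-- The group-like generator `g`. -/
def g : Sweedler k := ⟨0, 1, 0, 0⟩

/-- The skew-primitive generator `x`. -/
def x : Sweedler k := ⟨0, 0, 1, 0⟩

theorem g_mul_g : g k * g k = 1 := by ext <;> simp [g]

theorem x_mul_x : x k * x k = 0 := by ext <;> simp [x]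

theorem x_mul_g : x k * g k = -(g k * x k) := by ext <;> simp [g, x]

/-- The comultiplication: `Δ(g) = g ⊗ g` and `Δ(x) = x ⊗ 1 + g ⊗ x`. -/
def comulHom : Sweedler k →ₐ[k] Sweedler k ⊗[k] Sweedler k :=
  QuaternionAlgebra.Basis.liftHom
    { i := g k ⊗ₜ g k
      j := x k ⊗ₜ 1 + g k ⊗ₜ x k
      k := (g k ⊗ₜ g k) * (x k ⊗ₜ 1 + g k ⊗ₜ x k)
      i_mul_i := by
        simp [g_mul_g, Algebra.TensorProduct.one_def]
      j_mul_j := by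
        simp [mul_add, add_mul, x_mul_x, x_mul_g, TensorProduct.neg_tmul]
      i_mul_j := rfl
      j_mul_i := by
        simp [mul_add, add_mul, x_mul_g, TensorProduct.neg_tmul, TensorProduct.tmul_neg,
          add_comm] }

/-- The counit: `ε(g) = 1` and `ε(x) = 0`. -/
def counitHom : Sweedler k →ₐ[k] k :=
  QuaternionAlgebra.Basis.liftHom
    { i := 1, j := 0, k := 0
      i_mul_i := by simp
      j_mul_j := by simp
      i_mul_j := by simp
      j_mul_i := by simp }

theorem comulHom_g : comulHom k (g k) = g k ⊗ₜ g k := by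
  simp [comulHom, QuaternionAlgebra.Basis.lift, g]

theorem comulHom_x : comulHom k (x k) = x k ⊗ₜ 1 + g k ⊗ₜ x k := by
  simp [comulHom, QuaternionAlgebra.Basis.lift, x]

theorem counitHom_g : counitHom k (g k) = 1 := by
  simp [counitHom, QuaternionAlgebra.Basis.lift, g]

theorem counitHom_x : counitHom k (x k) = 0 := by
  simp [counitHom, QuaternionAlgebra.Basis.lift, x]

variable {k} in
/-- Algebra maps out of `H_4` are determined by the images of `g` and `x`. -/
theorem algHom_ext {A : Type*} [Ring A] [Algebra k A] {φ ψ : Sweedler k →ₐ[k] A}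
    (hg : φ (g k) = ψ (g k)) (hx : φ (x k) = ψ (x k)) : φ = ψ :=
  QuaternionAlgebra.hom_ext hg hx

instance : Bialgebra k (Sweedler k) :=
  Bialgebra.ofAlgHom (comulHom k) (counitHom k)
    (by
      apply algHom_ext
      · simp [comulHom_g]
      · simp [comulHom_x, comulHom_g, TensorProduct.tmul_add, TensorProduct.add_tmul,
          Algebra.TensorProduct.one_def, add_assoc])
    (by
      apply algHom_ext
      · simp [comulHom_g, counitHom_g]
      · simp [comulHom_x, counitHom_g, counitHom_x])
    (by
      apply algHom_ext
      · simp [comulHom_g, counitHom_g]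
      · simp [comulHom_x, counitHom_x])

theorem comul_g : Coalgebra.comul (R := k) (g k) = g k ⊗ₜ g k := comulHom_g k

theorem comul_x : Coalgebra.comul (R := k) (x k) = x k ⊗ₜ 1 + g k ⊗ₜ x k := comulHom_x k

theorem counit_g : Coalgebra.counit (R := k) (g k) = 1 := counitHom_g k

theorem counit_x : Coalgebra.counit (R := k) (x k) = 0 := counitHom_x k

variable {k} in
/-- `H_4` is spanned by `1, g, x, g x`. -/
theorem linear_ext {V : Type*} [AddCommGroup V] [Module k V] {φ ψ : Sweedler k →ₗ[k] V}
    (h1 : φ 1 = ψ 1) (hg : φ (g k) = ψ (g k)) (hx : φ (x k) = ψ (x k))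
    (hgx : φ (g k * x k) = ψ (g k * x k)) : φ = ψ := by
  ext a
  have ha : a = a.re • (1 : Sweedler k) + a.imI • g k + a.imJ • x k + a.imK • (g k * x k) := by
    ext <;> simp [g, x]
  rw [ha]
  simp only [map_add, map_smul, h1, hg, hx, hgx]

/-- The antipode: `S(1) = 1`, `S(g) = g`, `S(x) = - g x`, `S(g x) = x`. -/
def antipodeMap : Sweedler k →ₗ[k] Sweedler k where
  toFun a := ⟨a.re, a.imI, a.imK, -a.imJ⟩
  map_add' a b := by ext <;> simp [add_comm]
  map_smul' r a := by ext <;> simp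

theorem antipodeMap_one : antipodeMap k 1 = 1 := by ext <;> simp [antipodeMap]

theorem antipodeMap_g : antipodeMap k (g k) = g k := by ext <;> simp [antipodeMap, g]

theorem antipodeMap_x : antipodeMap k (x k) = -(g k * x k) := by
  ext <;> simp [antipodeMap, g, x]

theorem antipodeMap_gx : antipodeMap k (g k * x k) = x k := by
  ext <;> simp [antipodeMap, g, x]

theorem g_mul_gx : g k * (g k * x k) = x k := by rw [← mul_assoc, g_mul_g, one_mul]

theorem gx_mul_g : g k * x k * g k = -x k := by
  rw [mul_assoc, x_mul_g, mul_neg, g_mul_gx]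

instance : HopfAlgebra k (Sweedler k) where
  antipode := antipodeMap k
  mul_antipode_rTensor_comul := by
    apply linear_ext <;>
    simp [comul_g, comul_x, counit_g, counit_x, antipodeMap_one, antipodeMap_g, antipodeMap_x,
      antipodeMap_gx, g_mul_g, x_mul_g, Algebra.TensorProduct.one_def, mul_add]
  mul_antipode_lTensor_comul := by
    apply linear_ext <;>
    simp [comul_g, comul_x, counit_g, counit_x, antipodeMap_one, antipodeMap_g, antipodeMap_x,
      antipodeMap_gx, g_mul_g, g_mul_gx, gx_mul_g, Algebra.TensorProduct.one_def, mul_add]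

variable {k} in
/-- For `β ∈ k`, the algebra endomorphism `u_β` of `H_4` with `u_β(g) = g`, `u_β(x) = β x` and
`u_β(g x) = β g x`. -/
def scale (β : k) : Sweedler k →ₐ[k] Sweedler k where
  toFun a := ⟨a.re, a.imI, β * a.imJ, β * a.imK⟩
  map_one' := by ext <;> simp
  map_mul' a b := by ext <;> simp <;> ring
  map_zero' := by ext <;> simp
  map_add' a b := by ext <;> simp [mul_add]
  commutes' r := by ext <;> simp

theorem scale_g (β : k) : scale β (g k) = g k := by ext <;> simp [scale, g]

theorem scale_x (β : k) : scale β (x k) = β • x k := by ext <;> simp [scale, x]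

theorem scale_one : scale (1 : k) = AlgHom.id k _ := by
  apply algHom_ext <;> simp [scale_g, scale_x]

theorem scale_scale (β γ : k) (a : Sweedler k) : scale β (scale γ a) = scale (β * γ) a := by
  ext <;> simp [scale, mul_assoc]

theorem comul_scale (β : k) (a : Sweedler k) : Coalgebra.comul (R := k) (scale β a) =
    Algebra.TensorProduct.map (scale β) (scale β) (Coalgebra.comul (R := k) a) := by
  have h : (Bialgebra.comulAlgHom k (Sweedler k)).comp (scale β) =
      (Algebra.TensorProduct.map (scale β) (scale β)).comp
        (Bialgebra.comulAlgHom k (Sweedler k)) := by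
    apply algHom_ext
    · simp [scale_g, comul_g]
    · simp [scale_g, scale_x, comul_x, TensorProduct.smul_tmul']
  exact congr($h a)

theorem counit_scale (β : k) (a : Sweedler k) :
    Coalgebra.counit (R := k) (scale β a) = Coalgebra.counit (R := k) a := by
  have h : (Bialgebra.counitAlgHom k (Sweedler k)).comp (scale β) =
      Bialgebra.counitAlgHom k (Sweedler k) := by
    apply algHom_ext
    · simp [scale_g]
    · simp [scale_x, counit_x]
  exact congr($h a)

theorem cyc_two_cases : ∀ γ : Cyc 2, γ = 1 ∨ γ = gen 2 := by decide

theorem cyc_two_mul_self : ∀ γ : Cyc 2, γ * γ = 1 := by decide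

/-- The identification of `C_2` with the group `{1, g}` of group-like elements of `H_4`. -/
def grp : Cyc 2 →* Sweedler k where
  toFun γ := if γ = 1 then 1 else g k
  map_one' := by simp
  map_mul' a b := by
    rcases cyc_two_cases a with rfl | rfl <;> rcases cyc_two_cases b with rfl | rfl <;>
    simp [show gen 2 ≠ 1 by decide, show gen 2 * gen 2 = 1 by decide, g_mul_g]

theorem grp_gen : grp k (gen 2) = g k := by simp [grp, show gen 2 ≠ 1 by decide]

theorem comul_grp (γ : Cyc 2) :
    Coalgebra.comul (R := k) (grp k γ) = grp k γ ⊗ₜ grp k γ := by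
  rcases cyc_two_cases γ with rfl | rfl
  · simp [Algebra.TensorProduct.one_def]
  · simp [grp_gen, comul_g]

theorem counit_grp (γ : Cyc 2) : Coalgebra.counit (R := k) (grp k γ) = 1 := by
  rcases cyc_two_cases γ with rfl | rfl
  · simp
  · simp [grp_gen, counit_g]

theorem antipode_grp (γ : Cyc 2) : HopfAlgebra.antipode k (grp k γ) = grp k γ := by
  rcases cyc_two_cases γ with rfl | rfl
  · simp
  · rw [grp_gen]
    exact antipodeMap_g k

theorem scale_grp (β : k) (γ : Cyc 2) : scale β (grp k γ) = grp k γ := by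
  rcases cyc_two_cases γ with rfl | rfl
  · simp
  · simp [grp_gen, scale_g]

theorem orderOf_gen_two : orderOf (gen 2) = 2 :=
  orderOf_eq_prime (by decide) (by decide)

/-- Moving a group-like element past an element of `H_4`. -/
theorem mul_grp (γ : Cyc 2) (a : Sweedler k) :
    a * grp k γ = grp k γ * scale ((-1) ^ (1 + orderOf γ)) a := by
  rcases cyc_two_cases γ with rfl | rfl
  · simp [scale_one]
  · rw [grp_gen, orderOf_gen_two]
    ext <;> simp [scale, g] <;> ring

end Sweedler

end Sweedler

/-! ### The crossed system attached to a pair `(t, λ)` -/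

section CrossedSystem

variable {k : Type*} [Field k] {n : ℕ}

/-- The product `t(c^0) t(c^1) ⋯ t(c^(i-1))`. -/
def tProd (t : Cyc n → Cyc 2) (i : ℕ) : Cyc 2 := ∏ p ∈ Finset.range i, t (gen n ^ p)

/-- The cocycle `f_t(c^i, c^j) = ∏_{p<i} t(c^p) ∏_{q<j} t(c^q) ∏_{r<i+j} t(c^r)`, on exponents. -/
def cocExp (t : Cyc n → Cyc 2) (i j : ℕ) : Cyc 2 := tProd t i * tProd t j * tProd t (i + j)

/-- The cocycle `f_t : C_n × C_n → C_2`. -/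
def coc (t : Cyc n → Cyc 2) (h h' : Cyc n) : Cyc 2 := cocExp t (expo h) (expo h')

/-- The scalar `(-1) ^ σ_t(j) λ ^ j`. -/
def weightExp (D : CS k n) (j : ℕ) : k := (-1) ^ sigma D.t j * (D.lam : k) ^ j

/-- The scalar by which `h ∈ C_n` acts on `x`. -/
def weight (D : CS k n) (h : Cyc n) : k := weightExp D (expo h)

/-- The action of `C_n` on `H_4`: `c^j ▷ g = g`, `c^j ▷ x = (-1) ^ σ_t(j) λ ^ j x`,
`c^j ▷ (g x) = (-1) ^ σ_t(j) λ ^ j g x`. -/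
def act (D : CS k n) (h : Cyc n) : Sweedler k →ₐ[k] Sweedler k := Sweedler.scale (weight D h)

theorem tProd_succ (t : Cyc n → Cyc 2) (i : ℕ) :
    tProd t (i + 1) = tProd t i * t (gen n ^ i) := Finset.prod_range_succ _ _

theorem gen_pow (n : ℕ) : gen n ^ n = 1 := by
  apply Multiplicative.toAdd.injective
  simp [gen]

theorem tProd_add (t : Cyc n → Cyc 2) (i : ℕ) : tProd t (n + i) = tProd t n * tProd t i := by
  simp [tProd, Finset.prod_range_add, pow_add, gen_pow]

theorem neg_one_pow_mul (a b : Cyc 2) : (-1 : k) ^ (1 + orderOf (a * b)) =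
    (-1) ^ (1 + orderOf a) * (-1) ^ (1 + orderOf b) := by
  rcases Sweedler.cyc_two_cases a with rfl | rfl <;>
  rcases Sweedler.cyc_two_cases b with rfl | rfl <;>
  norm_num [show gen 2 * gen 2 = 1 by decide, Sweedler.orderOf_gen_two]

theorem neg_one_pow_sigma_succ (t : Cyc n → Cyc 2) (m : ℕ) : (-1 : k) ^ sigma t (m + 1) =
    (-1) ^ (m + ∑ p ∈ Finset.Icc 1 m, orderOf (t (gen n ^ p))) := by
  rcases Nat.eq_zero_or_pos m with rfl | hm
  · simp [sigma]
  · unfold sigma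
    rw [if_neg (by omega)]
    split_ifs with h
    · have : Odd m := by
        rw [Nat.even_add_one] at h
        exact Nat.not_even_iff_odd.mp h
      simp [pow_add, this.neg_one_pow]
    · have : Even m := by
        rw [Nat.even_add_one, not_not] at h
        exact h
      simp [pow_add, this.neg_one_pow]

theorem neg_one_pow_sigma (t : Cyc n → Cyc 2) (ht : t 1 = 1) (j : ℕ) :
    (-1 : k) ^ sigma t j = (-1) ^ (1 + orderOf (tProd t j)) := by
  induction j with
  | zero => simp [sigma, tProd]
  | succ m ih =>
    rw [tProd_succ, neg_one_pow_mul, ← ih, neg_one_pow_sigma_succ]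
    rcases m with _ | m
    · simp [sigma, ht]
    · rw [neg_one_pow_sigma_succ, Finset.sum_Icc_succ_top (by omega)]
      ring

theorem weightExp_mul (D : CS k n) (i j : ℕ) :
    weightExp D i * weightExp D j =
      (-1) ^ (1 + orderOf (cocExp D.t i j)) * weightExp D (i + j) := by
  simp only [weightExp, cocExp, neg_one_pow_sigma D.t D.t_one, neg_one_pow_mul]
  have h : ((-1 : k) ^ (1 + orderOf (tProd D.t (i + j)))) *
      (-1) ^ (1 + orderOf (tProd D.t (i + j))) = 1 := by
    rw [← neg_one_pow_mul, Sweedler.cyc_two_mul_self]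
    simp
  rw [pow_add (D.lam : k) i j]
  linear_combination (-(-1 : k) ^ (1 + orderOf (tProd D.t i)) *
    (-1 : k) ^ (1 + orderOf (tProd D.t j)) * (D.lam : k) ^ i * (D.lam : k) ^ j) * h

theorem weightExp_self (D : CS k n) : weightExp D n = 1 := by
  have h : (D.lam : k) ^ n = (-1) ^ sigma D.t n := by
    have := congr(($(D.lam_pow) : k))
    simpa using this
  rw [weightExp, h, ← mul_pow]
  simp

theorem weightExp_add (D : CS k n) (j : ℕ) : weightExp D (n + j) = weightExp D j := by
  have h := weightExp_mul D n j
  have h' : cocExp D.t n j = 1 := by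
    rw [cocExp, tProd_add, Sweedler.cyc_two_mul_self]
  rw [weightExp_self, h'] at h
  simpa using h.symm

theorem weightExp_mod (D : CS k n) (j : ℕ) : weightExp D (j % n) = weightExp D j := by
  conv_rhs => rw [← Nat.mod_add_div j n]
  induction j / n with
  | zero => simp
  | succ m ih =>
    rw [ih, ← weightExp_add D (j % n + n * m)]
    congr 1
    ring

theorem cocExp_add_left (t : Cyc n → Cyc 2) (i j : ℕ) : cocExp t (n + i) j = cocExp t i j := by
  rw [cocExp, cocExp, add_assoc, tProd_add, tProd_add,
    mul_comm (tProd t n) (tProd t (i + j)), mul_mul_mul_comm, mul_comm (tProd t n),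
    mul_assoc, mul_right_comm]
  have := Sweedler.cyc_two_mul_self (tProd t n)
  generalize tProd t n = a at *
  generalize tProd t i = b at *
  generalize tProd t j = c at *
  generalize tProd t (i + j) = d at *
  revert a b c d
  decide

theorem cocExp_comm (t : Cyc n → Cyc 2) (i j : ℕ) : cocExp t i j = cocExp t j i := by
  rw [cocExp, cocExp, add_comm j i, mul_comm (tProd t i)]

theorem cocExp_mod_left (t : Cyc n → Cyc 2) (i j : ℕ) :
    cocExp t (i % n) j = cocExp t i j := by
  conv_rhs => rw [← Nat.mod_add_div i n]
  induction i / n with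
  | zero => simp
  | succ m ih =>
    rw [ih, ← cocExp_add_left t (i % n + n * m)]
    congr 1
    ring

theorem cocExp_mod_right (t : Cyc n → Cyc 2) (i j : ℕ) :
    cocExp t i (j % n) = cocExp t i j := by
  rw [cocExp_comm, cocExp_mod_left, cocExp_comm]

theorem cocExp_cocycle (t : Cyc n → Cyc 2) (i j l : ℕ) :
    cocExp t i j * cocExp t (i + j) l = cocExp t j l * cocExp t i (j + l) := by
  simp only [cocExp, ← add_assoc]
  generalize tProd t i = a
  generalize tProd t j = b
  generalize tProd t l = c
  generalize tProd t (i + j) = d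
  generalize tProd t (j + l) = e
  generalize tProd t (i + j + l) = f
  revert a b c d e f
  decide

theorem expo_gen_pow (i : ℕ) : expo (gen n ^ i) = i % n := by
  simp [expo, gen, ZMod.val_natCast]

theorem expo_one : expo (1 : Cyc n) = 0 := ZMod.val_zero

theorem coc_comm (t : Cyc n → Cyc 2) (h h' : Cyc n) : coc t h h' = coc t h' h :=
  cocExp_comm _ _ _

/-- `c^j ▷ x = (-1) ^ σ_t(j) λ ^ j x` for every exponent `j`. -/
theorem weight_gen_pow (D : CS k n) (j : ℕ) :
    weight D (gen n ^ j) = (-1) ^ sigma D.t j * (D.lam : k) ^ j := by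
  rw [weight, expo_gen_pow, weightExp_mod, weightExp]

/-- The formula for `f_t(c^i, c^j)` holds for all exponents. -/
theorem coc_gen_pow (t : Cyc n → Cyc 2) (i j : ℕ) :
    coc t (gen n ^ i) (gen n ^ j) = tProd t i * tProd t j * tProd t (i + j) := by
  rw [coc, expo_gen_pow, expo_gen_pow, cocExp_mod_left, cocExp_mod_right, cocExp]

theorem coc_one_left (t : Cyc n → Cyc 2) (h : Cyc n) : coc t 1 h = 1 := by
  rw [coc, expo_one, cocExp, zero_add, mul_assoc, Sweedler.cyc_two_mul_self]
  simp [tProd]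

theorem coc_one_right (t : Cyc n → Cyc 2) (h : Cyc n) : coc t h 1 = 1 := by
  rw [coc_comm, coc_one_left]

theorem weight_one (D : CS k n) : weight D 1 = 1 := by
  simp [weight, expo_one, weightExp, sigma]

theorem act_one (D : CS k n) (a : Sweedler k) : act D 1 a = a := by
  rw [act, weight_one, Sweedler.scale_one, AlgHom.id_apply]

variable [NeZero n]

theorem expo_mul (h h' : Cyc n) : expo (h * h') = (expo h + expo h') % n :=
  ZMod.val_add _ _

theorem gen_pow_expo (h : Cyc n) : gen n ^ expo h = h := by
  apply Multiplicative.toAdd.injective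
  simp [expo, gen]

theorem coc_cocycle (t : Cyc n → Cyc 2) (h h' l : Cyc n) :
    coc t h h' * coc t (h * h') l = coc t h' l * coc t h (h' * l) := by
  simp only [coc, expo_mul, cocExp_mod_left, cocExp_mod_right, cocExp_cocycle]

theorem weight_mul (D : CS k n) (h h' : Cyc n) : weight D h * weight D h' =
    (-1) ^ (1 + orderOf (coc D.t h h')) * weight D (h * h') := by
  simp only [weight, coc, expo_mul, weightExp_mod, weightExp_mul]

theorem act_act (D : CS k n) (h h' : Cyc n) (a : Sweedler k) :
    act D h (act D h' a) * Sweedler.grp k (coc D.t h h') =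
      Sweedler.grp k (coc D.t h h') * act D (h * h') a := by
  rw [Sweedler.mul_grp]
  simp only [act, Sweedler.scale_scale, weight_mul, ← mul_assoc]
  congr 2
  rw [← neg_one_pow_mul, Sweedler.cyc_two_mul_self]
  simp

end CrossedSystem

/-! ### The crossed product `H_{4n, λ, t} = H_4 # k[C_n]` -/

section CrossedProduct

variable {k : Type*} [Field k] {n : ℕ}

/-- The underlying vector space `H_4 ⊗ k[C_n]` of `H_{4n, λ, t}`. It is a separate type because its
multiplication is not the one of the tensor product of algebras. -/
def H4n (_ : CS k n) : Type _ := Sweedler k ⊗[k] MonoidAlgebra k (Cyc n)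

namespace H4n

instance instAddCommGroup (D : CS k n) : AddCommGroup (H4n D) :=
  inferInstanceAs (AddCommGroup (Sweedler k ⊗[k] MonoidAlgebra k (Cyc n)))

instance (D : CS k n) : Module k (H4n D) :=
  inferInstanceAs (Module k (Sweedler k ⊗[k] MonoidAlgebra k (Cyc n)))

/-- The coalgebra structure is the one of the tensor product of coalgebras. -/
instance instCoalgebra (D : CS k n) : Coalgebra k (H4n D) :=
  inferInstanceAs (Coalgebra k (Sweedler k ⊗[k] MonoidAlgebra k (Cyc n)))

/-- The element `a # h = a ⊗ h`. -/
def smash (D : CS k n) (a : Sweedler k) (h : Cyc n) : H4n D :=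
  a ⊗ₜ[k] MonoidAlgebra.single h (1 : k)

/-- The linear map `a ↦ a # h`. -/
def smashLin (D : CS k n) (h : Cyc n) : Sweedler k →ₗ[k] H4n D :=
  (TensorProduct.mk k (Sweedler k) (MonoidAlgebra k (Cyc n))).flip (MonoidAlgebra.single h 1)

theorem smashLin_apply (D : CS k n) (h : Cyc n) (a : Sweedler k) :
    smashLin D h a = smash D a h := rfl

variable {V : Type*} [AddCommGroup V] [Module k V]

/-- The linear map on `H_4 ⊗ k[C_n]` with `a # h ↦ v h a`. -/
def extend (D : CS k n) (v : Cyc n → Sweedler k →ₗ[k] V) : H4n D →ₗ[k] V :=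
  TensorProduct.lift
    ((Finsupp.linearCombination k v ∘ₗ
      (MonoidAlgebra.coeffLinearEquiv k).toLinearMap).flip)

theorem extend_smash (D : CS k n) (v : Cyc n → Sweedler k →ₗ[k] V) (a : Sweedler k) (h : Cyc n) :
    extend D v (smash D a h) = v h a :=
  (TensorProduct.lift.tmul _ _).trans (by simp)

theorem smash_add (D : CS k n) (a b : Sweedler k) (h : Cyc n) :
    smash D (a + b) h = smash D a h + smash D b h := TensorProduct.add_tmul _ _ _

theorem smash_smul (D : CS k n) (r : k) (a : Sweedler k) (h : Cyc n) :
    smash D (r • a) h = r • smash D a h := rfl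

/-- `H_4 ⊗ k[C_n]` is spanned by the elements `a # h`. -/
theorem induction {D : CS k n} {p : H4n D → Prop} (h0 : p 0)
    (hs : ∀ a h, p (smash D a h)) (hadd : ∀ z w, p z → p w → p (z + w)) (z : H4n D) : p z := by
  induction z using TensorProduct.induction_on with
  | zero => exact h0
  | add z w hz hw => exact hadd z w hz hw
  | tmul a u =>
    induction u using MonoidAlgebra.induction_linear with
    | zero => rw [TensorProduct.tmul_zero]; exact h0
    | add u v hu hv => rw [TensorProduct.tmul_add]; exact hadd _ _ hu hv
    | single h r =>
      have : a ⊗ₜ[k] MonoidAlgebra.single h r = smash D (r • a) h := by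
        rw [smash, TensorProduct.smul_tmul]
        simp
      rw [this]
      exact hs _ _

theorem linear_ext {D : CS k n} {φ ψ : H4n D →ₗ[k] V}
    (h : ∀ a h, φ (smash D a h) = ψ (smash D a h)) : φ = ψ := by
  apply LinearMap.ext
  apply induction
  · simp
  · exact h
  · intro z w hz hw
    rw [map_add, map_add, hz, hw]

/-- The bilinear map `(a, b) ↦ a (h ▷ b) f(h, h') # h h'`. -/
def mulAux (D : CS k n) (h h' : Cyc n) : Sweedler k →ₗ[k] Sweedler k →ₗ[k] H4n D :=
  LinearMap.mk₂ k
    (fun a b => smash D (a * act D h b * Sweedler.grp k (coc D.t h h')) (h * h'))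
    (fun a a' b => by simp only [add_mul, smash_add])
    (fun r a b => by simp only [smul_mul_assoc, smash_smul])
    (fun a b b' => by simp only [map_add, mul_add, add_mul, smash_add])
    (fun r a b => by simp only [map_smul, smul_mul_assoc, mul_smul_comm, smash_smul])

/-- The multiplication of the crossed product,
`(a # h) (b # h') = a (h ▷ b) f(h, h') # h h'` for `a, b ∈ H_4` and `h, h' ∈ C_n`. -/
def mulMap (D : CS k n) : H4n D →ₗ[k] H4n D →ₗ[k] H4n D :=
  extend D fun h => (extend D fun h' => (mulAux D h h').flip).flip

instance (D : CS k n) : Mul (H4n D) := ⟨fun z w => mulMap D z w⟩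

instance (D : CS k n) : One (H4n D) := ⟨smash D 1 1⟩

theorem one_def (D : CS k n) : (1 : H4n D) = smash D 1 1 := rfl

theorem mul_def (D : CS k n) (z w : H4n D) : z * w = mulMap D z w := rfl

theorem smash_mul_smash (D : CS k n) (a b : Sweedler k) (h h' : Cyc n) :
    smash D a h * smash D b h' =
      smash D (a * act D h b * Sweedler.grp k (coc D.t h h')) (h * h') := by
  rw [mul_def, mulMap, extend_smash, LinearMap.flip_apply, extend_smash]
  rfl

theorem comul_smash (D : CS k n) (a : Sweedler k) (h : Cyc n) :
    Coalgebra.comul (R := k) (smash D a h) =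
      TensorProduct.map (smashLin D h) (smashLin D h) (Coalgebra.comul (R := k) a) := by
  have e : Coalgebra.comul (R := k) (smash D a h) =
      TensorProduct.AlgebraTensorModule.tensorTensorTensorComm k k k k (Sweedler k) (Sweedler k)
        (MonoidAlgebra k (Cyc n)) (MonoidAlgebra k (Cyc n))
        (Coalgebra.comul (R := k) a ⊗ₜ[k]
          Coalgebra.comul (R := k) (MonoidAlgebra.single h (1 : k))) := rfl
  rw [e, MonoidAlgebra.comul_single]
  induction Coalgebra.comul (R := k) a using TensorProduct.induction_on with
  | zero =>
    rw [TensorProduct.zero_tmul, LinearEquiv.map_zero, LinearMap.map_zero]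
    rfl
  | add u v hu hv =>
    rw [TensorProduct.add_tmul, LinearEquiv.map_add, LinearMap.map_add, hu, hv]
    rfl
  | tmul u v =>
    simp [smashLin]
    rfl

theorem counit_smash (D : CS k n) (a : Sweedler k) (h : Cyc n) :
    Coalgebra.counit (R := k) (smash D a h) = Coalgebra.counit (R := k) a := by
  have e : Coalgebra.counit (R := k) (smash D a h) =
      Coalgebra.counit (R := k) (MonoidAlgebra.single h (1 : k)) •
        Coalgebra.counit (R := k) a := rfl
  rw [e, MonoidAlgebra.counit_single]
  simp

section Algebra

protected theorem one_mul' (D : CS k n) (z : H4n D) : 1 * z = z := by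
  induction z using induction with
  | h0 => rw [mul_def, map_zero]
  | hs a h =>
    rw [one_def, smash_mul_smash, act_one, coc_one_left, map_one, one_mul, one_mul, mul_one]
  | hadd z w hz hw => rw [mul_def, map_add, ← mul_def, ← mul_def, hz, hw]

protected theorem mul_one' (D : CS k n) (z : H4n D) : z * 1 = z := by
  induction z using induction with
  | h0 => rw [mul_def, map_zero, LinearMap.zero_apply]
  | hs a h =>
    rw [one_def, smash_mul_smash, map_one, coc_one_right, map_one, mul_one, mul_one, mul_one]
  | hadd z w hz hw =>
    rw [mul_def, map_add, LinearMap.add_apply, ← mul_def, ← mul_def, hz, hw]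

theorem smash_inv_mul (D : CS k n) (h : Cyc n) :
    smash D (Sweedler.grp k (coc D.t h⁻¹ h)) h⁻¹ * smash D 1 h = 1 := by
  rw [smash_mul_smash, map_one, mul_one, ← map_mul, Sweedler.cyc_two_mul_self, map_one,
    inv_mul_cancel, one_def]

theorem smash_mul_inv (D : CS k n) (h : Cyc n) :
    smash D 1 h * smash D (Sweedler.grp k (coc D.t h⁻¹ h)) h⁻¹ = 1 := by
  rw [smash_mul_smash, act, Sweedler.scale_grp, one_mul, coc_comm D.t h, ← map_mul,
    Sweedler.cyc_two_mul_self, map_one, mul_inv_cancel, one_def]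

theorem smash_one_mul (D : CS k n) (a b : Sweedler k) (h : Cyc n) :
    smash D a 1 * smash D b h = smash D (a * b) h := by
  rw [smash_mul_smash, act_one, coc_one_left, map_one, mul_one, one_mul]

variable [NeZero n]

theorem smash_assoc (D : CS k n) (a b c : Sweedler k) (h h' l : Cyc n) :
    smash D a h * smash D b h' * smash D c l = smash D a h * (smash D b h' * smash D c l) := by
  simp only [smash_mul_smash, map_mul, mul_assoc]
  have e : ∀ γ, act D h (Sweedler.grp k γ) = Sweedler.grp k γ := Sweedler.scale_grp k _
  rw [e]
  congr 3
  have h1 := coc_cocycle D.t h h' l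
  rw [← map_mul, ← h1, map_mul, ← mul_assoc, ← mul_assoc, ← act_act]

instance instRing (D : CS k n) : Ring (H4n D) where
  left_distrib z w w' := by simp only [mul_def, map_add]
  right_distrib z z' w := by simp only [mul_def, map_add, LinearMap.add_apply]
  zero_mul z := by simp only [mul_def, map_zero, LinearMap.zero_apply]
  mul_zero z := by simp only [mul_def, map_zero]
  mul_assoc z w u := by
    simp only [mul_def]
    induction z using induction with
    | h0 => simp only [map_zero, LinearMap.zero_apply]
    | hadd z z' hz hz' => simp only [map_add, LinearMap.add_apply, hz, hz']
    | hs a h =>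
      induction w using induction with
      | h0 => simp only [map_zero, LinearMap.zero_apply]
      | hadd z z' hz hz' => simp only [map_add, LinearMap.add_apply, hz, hz']
      | hs b h' =>
        induction u using induction with
        | h0 => simp only [map_zero]
        | hadd z z' hz hz' => simp only [map_add, hz, hz']
        | hs c l => exact smash_assoc D a b c h h' l
  one_mul := H4n.one_mul' D
  mul_one := H4n.mul_one' D
  __ := instAddCommGroup D

instance instAlgebra (D : CS k n) : Algebra k (H4n D) :=
  Algebra.ofModule
    (fun r z w => by simp only [mul_def, map_smul, LinearMap.smul_apply])
    (fun r z w => by simp only [mul_def, map_smul])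

theorem map_smash_mul (D : CS k n) (h h' : Cyc n) (u v : Sweedler k ⊗[k] Sweedler k) :
    TensorProduct.map (smashLin D h) (smashLin D h) u *
      TensorProduct.map (smashLin D h') (smashLin D h') v =
    TensorProduct.map (smashLin D (h * h')) (smashLin D (h * h'))
      (u * Algebra.TensorProduct.map (act D h) (act D h) v *
        (Sweedler.grp k (coc D.t h h') ⊗ₜ Sweedler.grp k (coc D.t h h'))) := by
  induction u using TensorProduct.induction_on with
  | zero => simp only [map_zero, zero_mul]
  | add u u' hu hu' => simp only [map_add, add_mul, hu, hu']
  | tmul a a' =>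
    induction v using TensorProduct.induction_on with
    | zero => simp only [map_zero, mul_zero, zero_mul]
    | add u u' hu hu' => simp only [map_add, mul_add, add_mul, hu, hu']
    | tmul b b' =>
      simp only [TensorProduct.map_tmul, Algebra.TensorProduct.map_tmul,
        Algebra.TensorProduct.tmul_mul_tmul, smashLin_apply, smash_mul_smash]

instance instBialgebra (D : CS k n) : Bialgebra k (H4n D) :=
  Bialgebra.mk' k (H4n D)
    (by rw [one_def, counit_smash, Bialgebra.counit_one])
    (by
      intro z w
      induction z using induction with
      | h0 => simp only [map_zero, zero_mul]
      | hadd z z' hz hz' => simp only [map_add, add_mul, hz, hz']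
      | hs a h =>
        induction w using induction with
        | h0 => simp only [map_zero, mul_zero]
        | hadd z z' hz hz' => simp only [map_add, mul_add, hz, hz']
        | hs b h' =>
          rw [smash_mul_smash, counit_smash, counit_smash, counit_smash, Bialgebra.counit_mul,
            Bialgebra.counit_mul, Sweedler.counit_grp, act, Sweedler.counit_scale, mul_one])
    (by
      rw [one_def, comul_smash, Bialgebra.comul_one, Algebra.TensorProduct.one_def,
        TensorProduct.map_tmul]
      rfl)
    (by
      intro z w
      induction z using induction with
      | h0 => simp only [map_zero, zero_mul]
      | hadd z z' hz hz' => simp only [map_add, add_mul, hz, hz']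
      | hs a h =>
        induction w using induction with
        | h0 => simp only [map_zero, mul_zero]
        | hadd z z' hz hz' => simp only [map_add, mul_add, hz, hz']
        | hs b h' =>
          rw [smash_mul_smash, comul_smash, comul_smash, comul_smash, map_smash_mul,
            Bialgebra.comul_mul, Bialgebra.comul_mul, Sweedler.comul_grp, act,
            Sweedler.comul_scale])

/-- The antipode, `S(a # h) = (S(f(h⁻¹, h)) # h⁻¹) (S(a) # 1)`. -/
def antipodeMap (D : CS k n) : H4n D →ₗ[k] H4n D :=
  extend D fun h =>
    LinearMap.mulLeft k
        (smash D (HopfAlgebra.antipode k (Sweedler.grp k (coc D.t h⁻¹ h))) h⁻¹) ∘ₗ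
      smashLin D 1 ∘ₗ HopfAlgebra.antipode k

theorem antipodeMap_smash (D : CS k n) (a : Sweedler k) (h : Cyc n) :
    antipodeMap D (smash D a h) = smash D (Sweedler.grp k (coc D.t h⁻¹ h)) h⁻¹ *
      smash D (HopfAlgebra.antipode k a) 1 := by
  rw [antipodeMap, extend_smash, Sweedler.antipode_grp]
  rfl

instance instHopfAlgebra (D : CS k n) : HopfAlgebra k (H4n D) where
  antipode := antipodeMap D
  mul_antipode_rTensor_comul := by
    have key : ∀ (h : Cyc n) (u : Sweedler k ⊗[k] Sweedler k),
        LinearMap.mul' k (H4n D) ((antipodeMap D).rTensor (H4n D)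
          (TensorProduct.map (smashLin D h) (smashLin D h) u)) =
        smash D (Sweedler.grp k (coc D.t h⁻¹ h)) h⁻¹ *
          smashLin D 1 (LinearMap.mul' k _ ((HopfAlgebra.antipode k).rTensor _ u)) *
            smash D 1 h := by
      intro h u
      induction u using TensorProduct.induction_on with
      | zero => simp only [map_zero, mul_zero, zero_mul]
      | add u u' hu hu' => simp only [map_add, mul_add, add_mul, hu, hu']
      | tmul a a' =>
        simp only [TensorProduct.map_tmul, LinearMap.rTensor_tmul, LinearMap.mul'_apply,
          smashLin_apply, antipodeMap_smash, mul_assoc, smash_one_mul, mul_one]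
    apply linear_ext
    intro a h
    simp only [LinearMap.comp_apply]
    rw [comul_smash, key, HopfAlgebra.mul_antipode_rTensor_comul_apply, counit_smash,
      Algebra.algebraMap_eq_smul_one, map_smul, smashLin_apply, ← one_def, mul_smul_comm, mul_one,
      smul_mul_assoc, smash_inv_mul, Algebra.linearMap_apply, Algebra.algebraMap_eq_smul_one]
  mul_antipode_lTensor_comul := by
    have key : ∀ (h : Cyc n) (u : Sweedler k ⊗[k] Sweedler k),
        LinearMap.mul' k (H4n D) ((antipodeMap D).lTensor (H4n D)
          (TensorProduct.map (smashLin D h) (smashLin D h) u)) =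
        smashLin D 1 (LinearMap.mul' k _ ((HopfAlgebra.antipode k).lTensor _ u)) := by
      intro h u
      induction u using TensorProduct.induction_on with
      | zero => simp only [map_zero]
      | add u u' hu hu' => simp only [map_add, hu, hu']
      | tmul a a' =>
        simp only [TensorProduct.map_tmul, LinearMap.lTensor_tmul, LinearMap.mul'_apply,
          smashLin_apply, antipodeMap_smash]
        have ha : smash D a h = smash D a 1 * smash D 1 h := by rw [smash_one_mul, mul_one]
        rw [ha, ← mul_assoc, mul_assoc (smash D a 1), smash_mul_inv, mul_one, smash_one_mul]
    apply linear_ext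
    intro a h
    simp only [LinearMap.comp_apply]
    rw [comul_smash, key, HopfAlgebra.mul_antipode_lTensor_comul_apply, counit_smash,
      Algebra.algebraMap_eq_smul_one, map_smul, smashLin_apply, ← one_def,
      Algebra.linearMap_apply, Algebra.algebraMap_eq_smul_one]

end Algebra

end H4n

end CrossedProduct

/-- The triples `(β, r, s)` of a scalar `β ∈ k*`, a unitary map `r : C_n → C_2` and an integer
`s ∈ {1, …, n}` with `gcd(s, n) = 1` that satisfy the cocycle and the scalar compatibility
conditions for `(t, λ)` and `(t', λ')`. For `n ≥ 2` the value `s = n` does not occur, since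
`gcd(n, n) = n`; for `n = 1` the only value is `s = 1`. -/
structure IsoTriple {k : Type*} [Field k] {n : ℕ} (D D' : CS k n) where
  /-- the scalar `β` -/
  beta : kˣ
  /-- the map `r : C_n → C_2` -/
  r : Cyc n → Cyc 2
  /-- the exponent `s` -/
  s : ℕ
  r_one : r 1 = 1
  one_le_s : 1 ≤ s
  s_le : s ≤ n
  gcd_eq : Nat.gcd s n = 1
  cocycle : ∀ i ∈ Finset.Icc 1 n, ∀ j ∈ Finset.Icc 1 n,
    ∏ p ∈ Finset.range i, D.t (gen n ^ p) * D.t (gen n ^ (p + j)) =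
      r (gen n ^ i) * r (gen n ^ j) * r (gen n ^ (i + j)) *
        ∏ q ∈ Finset.range (i * s), D'.t (gen n ^ q) * D'.t (gen n ^ (q + j * s))
  scalar : ∀ i ∈ Finset.Icc 1 n,
    (-1 : k) ^ (1 + sigma D.t i + orderOf (r (gen n ^ i))) * (D.lam : k) ^ i =
      (-1) ^ sigma D'.t (i * s) * (D'.lam : k) ^ (i * s)

end CrossedSweedler

end

/-!
A Hopf algebra isomorphism `ψ : H_{4n, λ, t} → H_{4n, λ', t'}` is determined by the images of
`a # 1`, `a ∈ H_4`, and of `1 # h`, `h ∈ C_n`. Both are pinned down by the coalgebra structure,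
which is the direct sum of the copies `H_4 # h` of `H_4`.

* The group-like elements are the `γ # h` with `γ ∈ {1, g}` and `h ∈ C_n`
  (`H4n.exists_eq_smash_of_isGroupLikeElem`), so `ψ(1 # h) = r(h) # v(h)`.
* Over a group-like `γ # h` with `h ≠ 1` the only skew-primitive elements are the multiples of
  `1 - γ # h` (`H4n.eq_smul_one_sub_of_comul_eq`). Since `x # 1` is a nontrivial one over `g # 1`,
  the map `ψ` fixes `g # 1` (`apply_inl_g`), and it maps `x # 1` to `(α (1 - g) + β x) # 1`
  (`H4n.eq_smash_of_comul_eq`). From `x² = 0` and `2 ≠ 0` one gets `α = 0`, so `ψ` restricts to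
  `u_β` on `H_4` (`exists_apply_inl`).

Hence `ψ(a # h) = u_β(a) r(h) # v(h)`. Multiplicativity on `(1 # h) (1 # h')` says that `v` is a
homomorphism and that the two cocycles differ by the coboundary of `r`; on `(1 # h) (x # 1)` it
gives the condition on the scalars. These two conditions are `Compatible`, which is a reformulation
of the conditions on a triple since `∏_{p<i} t(c^p) t(c^{p+j}) = f_t(c^i, c^j)` (`prod_mul_shift`);
injectivity of `ψ` forces `v` to be injective, so `v(h) = h^s` with `s` prime to `n`. Conversely,
compatible data define a bialgebra map with an inverse of the same shape (`H4n.twist_twist`).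
-/

noncomputable section

namespace CrossedSweedler

/-! ### Group-like and skew-primitive elements of `H_4` -/

namespace Sweedler

variable {k : Type*} [Field k]

theorem grp_injective : Function.Injective (grp k) := by
  intro γ δ h
  rcases cyc_two_cases γ with rfl | rfl <;> rcases cyc_two_cases δ with rfl | rfl
  · rfl
  · rw [grp_gen, map_one] at h
    simpa [g] using congr(QuaternionAlgebra.re $h)
  · rw [grp_gen, map_one] at h
    simpa [g] using congr(QuaternionAlgebra.re $h)
  · rfl

theorem grp_mul_self (γ : Cyc 2) : grp k γ * grp k γ = 1 := by
  rw [← map_mul, cyc_two_mul_self, map_one]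

theorem eq_sum_basis (a : Sweedler k) :
    a = a.re • (1 : Sweedler k) + a.imI • g k + a.imJ • x k + a.imK • (g k * x k) := by
  ext <;> simp [g, x]

theorem comul_eq_sum (a : Sweedler k) : Coalgebra.comul (R := k) a =
    a.re • (1 ⊗ₜ 1) + a.imI • (g k ⊗ₜ g k) + a.imJ • (x k ⊗ₜ 1 + g k ⊗ₜ x k) +
      a.imK • ((g k * x k) ⊗ₜ g k + 1 ⊗ₜ (g k * x k)) := by
  conv_lhs => rw [eq_sum_basis a]
  simp only [map_add, map_smul, Bialgebra.comul_one, Bialgebra.comul_mul, comul_g, comul_x,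
    mul_add, Algebra.TensorProduct.tmul_mul_tmul, mul_one, g_mul_g, Algebra.TensorProduct.one_def]

theorem grp_ne_zero (γ : Cyc 2) : grp k γ ≠ 0 := fun h => by
  simpa [h] using grp_mul_self (k := k) γ

/-- The coordinate functionals of the basis `1, g, x, g x`. -/
def coord : Fin 4 → Sweedler k →ₗ[k] k :=
  ![QuaternionAlgebra.reₗ 1 0 0, QuaternionAlgebra.imIₗ 1 0 0, QuaternionAlgebra.imJₗ 1 0 0,
    QuaternionAlgebra.imKₗ 1 0 0]

/-- The matrix entries of a tensor with respect to the basis `1, g, x, g x` in both factors. -/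
def entry (i j : Fin 4) : Sweedler k ⊗[k] Sweedler k →ₗ[k] k :=
  LinearMap.mul' k k ∘ₗ TensorProduct.map (coord i) (coord j)

theorem entry_tmul (i j : Fin 4) (a b : Sweedler k) :
    entry i j (a ⊗ₜ[k] b) = coord i a * coord j b := rfl

/-- The group-like elements of `H_4` are `1` and `g`. -/
theorem exists_grp_of_comul_eq {a : Sweedler k} (ha : Coalgebra.comul (R := k) a = a ⊗ₜ a)
    (ha0 : a ≠ 0) : ∃ γ, a = grp k γ := by
  rw [comul_eq_sum] at ha
  have e := fun i j => congr(entry i j $ha)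
  have h00 := e 0 0
  have h01 := e 0 1
  have h11 := e 1 1
  have h22 := e 2 2
  have h33 := e 3 3
  simp [entry_tmul, coord, g, x] at h00 h01 h11 h22 h33
  rcases h01 with h0 | h0
  · have h1 : a.imI ≠ 0 := fun h1 => ha0 (by ext <;> simp [h0, h1, h22, h33])
    refine ⟨gen 2, ?_⟩
    rw [grp_gen]
    ext <;> simp [g, h0, h22, h33, mul_left_cancel₀ h1 (h11.symm.trans (mul_one _).symm)]
  · have h1 : a.re ≠ 0 := fun h1 => ha0 (by ext <;> simp [h0, h1, h22, h33])
    refine ⟨1, ?_⟩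
    rw [map_one]
    ext <;> simp [h0, h22, h33, mul_left_cancel₀ h1 (h00.symm.trans (mul_one _).symm)]

/-- An element with `Δ(a) = a ⊗ 1 + g ⊗ a` is a combination of `1 - g` and `x`. -/
theorem eq_of_comul_eq_add {a : Sweedler k}
    (ha : Coalgebra.comul (R := k) a = a ⊗ₜ 1 + g k ⊗ₜ a) :
    a = a.re • (1 - g k) + a.imJ • x k := by
  rw [comul_eq_sum] at ha
  have e := fun i j => congr(entry i j $ha)
  have h03 := e 0 3
  have h10 := e 1 0
  simp [entry_tmul, coord, g, x] at h03 h10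
  ext
  · simp [g, x]
  · simpa [g, x] using eq_neg_of_add_eq_zero_left h10.symm
  · simp [g, x]
  · simp [g, x, h03]

end Sweedler

/-! ### The grading of `H_4 # k[C_n]`, its group-like and skew-primitive elements -/

namespace H4n

variable {k : Type*} [Field k] {n : ℕ}

/-- The component `b_h ∈ H_4` of an element `∑ b_h # h` of `H_4 ⊗ k[C_n]`. -/
def comp (D : CS k n) (h : Cyc n) : H4n D →ₗ[k] Sweedler k :=
  extend D fun h' => if h' = h then LinearMap.id else 0

theorem comp_smash (D : CS k n) (h h' : Cyc n) (a : Sweedler k) :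
    comp D h (smash D a h') = if h' = h then a else 0 := by
  rw [comp, extend_smash]
  split_ifs <;> rfl

theorem comp_smash_self (D : CS k n) (h : Cyc n) (a : Sweedler k) :
    comp D h (smash D a h) = a := by
  rw [comp_smash, if_pos rfl]

theorem smash_injective (D : CS k n) (h : Cyc n) :
    Function.Injective fun a => smash D a h :=
  Function.LeftInverse.injective (comp_smash_self D h)

theorem eq_and_eq_of_smash_eq {D : CS k n} {a b : Sweedler k} {h h' : Cyc n} (ha : a ≠ 0)
    (e : smash D a h = smash D b h') : a = b ∧ h = h' := by
  have e' := congr(comp D h $e)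
  rw [comp_smash_self, comp_smash] at e'
  split_ifs at e' with hh
  · exact ⟨e', hh.symm⟩
  · exact absurd e' ha

/-- The comultiplication is diagonal for the grading of `H_4 ⊗ k[C_n]` by `C_n`. -/
theorem map_comp_comul (D : CS k n) (h h' : Cyc n) (z : H4n D) :
    TensorProduct.map (comp D h) (comp D h') (Coalgebra.comul (R := k) z) =
      if h = h' then Coalgebra.comul (R := k) (comp D h z) else 0 := by
  induction z using induction with
  | h0 => simp
  | hadd z w hz hw =>
    rw [map_add, map_add, hz, hw, map_add, map_add]
    split_ifs <;> simp
  | hs a l =>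
    rw [comul_smash]
    have key : ∀ u : Sweedler k ⊗[k] Sweedler k, TensorProduct.map (comp D h) (comp D h')
        (TensorProduct.map (smashLin D l) (smashLin D l) u) =
          if l = h ∧ l = h' then u else 0 := by
      intro u
      induction u using TensorProduct.induction_on with
      | zero => simp
      | add u v hu hv =>
        rw [map_add, map_add, hu, hv]
        split_ifs <;> simp
      | tmul u v =>
        rw [TensorProduct.map_tmul, TensorProduct.map_tmul, smashLin_apply, smashLin_apply,
          comp_smash, comp_smash]
        by_cases hl : l = h
        · subst hl
          by_cases hl' : l = h' <;> simp [hl']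
        · simp [hl]
    rw [key, comp_smash]
    by_cases hl : l = h
    · subst hl
      by_cases hl' : l = h' <;> simp [hl']
    · simp [hl]

variable [NeZero n]

theorem sum_smash_comp {D : CS k n} (z : H4n D) : ∑ h, smash D (comp D h z) h = z := by
  induction z using induction with
  | h0 => simp only [map_zero, ← smashLin_apply, Finset.sum_const_zero]
  | hadd z w hz hw =>
    conv_rhs => rw [← hz, ← hw]
    simp only [map_add, smash_add, Finset.sum_add_distrib]
  | hs a l =>
    rw [Finset.sum_eq_single l, comp_smash_self]
    · intro h _ hh
      rw [comp_smash, if_neg hh.symm, ← smashLin_apply, map_zero]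
    · simp

theorem eq_smash_of_comp_eq_zero {D : CS k n} {z : H4n D} (h : Cyc n)
    (hz : ∀ l, l ≠ h → comp D l z = 0) : z = smash D (comp D h z) h := by
  conv_lhs => rw [← sum_smash_comp z]
  apply Finset.sum_eq_single h
  · intro l _ hl
    rw [hz l hl, ← smashLin_apply, map_zero]
  · simp

theorem isGroupLikeElem_smash_grp (D : CS k n) (γ : Cyc 2) (h : Cyc n) :
    IsGroupLikeElem k (smash D (Sweedler.grp k γ) h) where
  counit_eq_one := by rw [counit_smash, Sweedler.counit_grp]
  comul_eq_tmul_self := by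
    rw [comul_smash, Sweedler.comul_grp, TensorProduct.map_tmul, smashLin_apply]

/-- The group-like elements of `H_4 # k[C_n]` are the `γ # h` with `γ ∈ C_2` and `h ∈ C_n`. -/
theorem exists_eq_smash_of_isGroupLikeElem {D : CS k n} {z : H4n D} (hz : IsGroupLikeElem k z) :
    ∃ γ h, z = smash D (Sweedler.grp k γ) h := by
  have hc := fun h h' => map_comp_comul D h h' z
  simp only [hz.comul_eq_tmul_self, TensorProduct.map_tmul] at hc
  -- `ε(z) = 1`, so the counit does not vanish on some component; by `Δ(z) = z ⊗ z` and the diagonal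
  -- form of `Δ`, all other components are zero
  obtain ⟨h, hh⟩ : ∃ h, Coalgebra.counit (R := k) (comp D h z) ≠ 0 := by
    by_contra! H
    have := hz.counit_eq_one
    rw [← sum_smash_comp z] at this
    simp [counit_smash, H] at this
  have hs : z = smash D (comp D h z) h := by
    apply eq_smash_of_comp_eq_zero
    intro l hl
    have e := congr(TensorProduct.lid k _ ((Coalgebra.counit (R := k)).rTensor _ $(hc h l)))
    rw [if_neg hl.symm] at e
    simpa [hh] using e
  obtain ⟨γ, hγ⟩ := Sweedler.exists_grp_of_comul_eq (a := comp D h z)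
    (by simpa using (hc h h).symm) (by rintro e; simp [e] at hh)
  exact ⟨γ, h, by rw [← hγ, ← hs]⟩

/-- Skew-primitive elements over a group-like element `γ # h` with `h ≠ 1` are trivial: off the
diagonal of the grading the equation reads `z_h ⊗ 1 = -γ ⊗ z_1` and `z_l ⊗ 1 = 0`, `l ≠ 1, h`. -/
theorem eq_smul_one_sub_of_comul_eq {D : CS k n} {z : H4n D} {γ : Cyc 2} {h : Cyc n} (hh : h ≠ 1)
    (hz : Coalgebra.comul (R := k) z = z ⊗ₜ 1 + smash D (Sweedler.grp k γ) h ⊗ₜ z) :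
    ∃ α : k, z = α • (1 - smash D (Sweedler.grp k γ) h) := by
  have hc := fun l l' => map_comp_comul D l l' z
  simp only [hz, map_add, TensorProduct.map_tmul, one_def, comp_smash] at hc
  have h1 : comp D 1 z = Coalgebra.counit (R := k) (comp D 1 z) • (1 : Sweedler k) := by
    have e := congr(TensorProduct.lid k _ ((Coalgebra.counit (R := k)).rTensor _ $(hc 1 1)))
    simpa [hh] using e.symm
  have h2 : comp D h z = -Coalgebra.counit (R := k) (comp D 1 z) • Sweedler.grp k γ := by
    have e := congr(TensorProduct.rid k _ ((Coalgebra.counit (R := k)).lTensor _ $(hc h 1)))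
    simp [hh] at e
    rw [eq_neg_of_add_eq_zero_left e, neg_smul]
  have h3 : ∀ l, l ≠ 1 → l ≠ h → comp D l z = 0 := by
    intro l hl hl'
    have e := congr(TensorProduct.rid k _ ((Coalgebra.counit (R := k)).lTensor _ $(hc l 1)))
    simpa [hl, hl.symm, hl'.symm] using e
  refine ⟨Coalgebra.counit (R := k) (comp D 1 z), ?_⟩
  rw [← sub_eq_zero, ← sum_smash_comp (z - _)]
  apply Finset.sum_eq_zero
  intro l _
  rw [← smashLin_apply]
  convert map_zero (smashLin D l)
  rw [map_sub, map_smul, map_sub, one_def, comp_smash, comp_smash]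
  by_cases hl : l = 1
  · subst hl
    rw [if_pos rfl, if_neg hh, sub_zero, ← h1, sub_self]
  · by_cases hl' : l = h
    · subst hl'
      rw [if_neg (Ne.symm hl), if_pos rfl, h2]
      simp
    · rw [if_neg (Ne.symm hl), if_neg (Ne.symm hl'), h3 l hl hl']
      simp

/-- Skew-primitive elements over `g # 1` come from `H_4`. -/
theorem eq_smash_of_comul_eq {D : CS k n} {z : H4n D}
    (hz : Coalgebra.comul (R := k) z = z ⊗ₜ 1 + smash D (Sweedler.g k) 1 ⊗ₜ z) :
    ∃ α β : k, z = smash D (α • (1 - Sweedler.g k) + β • Sweedler.x k) 1 := by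
  have hc := fun l l' => map_comp_comul D l l' z
  simp only [hz, map_add, TensorProduct.map_tmul, one_def, comp_smash] at hc
  have hs : z = smash D (comp D 1 z) 1 := by
    apply eq_smash_of_comp_eq_zero
    intro l hl
    have e := congr(TensorProduct.rid k _ ((Coalgebra.counit (R := k)).lTensor _ $(hc l 1)))
    simpa [hl, hl.symm] using e
  refine ⟨(comp D 1 z).re, (comp D 1 z).imJ, ?_⟩
  rw [← Sweedler.eq_of_comul_eq_add (by simpa using (hc 1 1).symm)]
  exact hs

/-- The embedding `a ↦ a # 1` of `H_4`. -/
def inl (D : CS k n) : Sweedler k →ₐ[k] H4n D :=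
  AlgHom.ofLinearMap (smashLin D 1) rfl fun a b => (by
    simp only [smashLin_apply, smash_one_mul])

theorem inl_apply (D : CS k n) (a : Sweedler k) : inl D a = smash D a 1 := rfl

end H4n

/-! ### Compatibility of crossed systems -/

section Compatible

variable {k : Type*} [Field k] {n : ℕ}

/-- Reindexing the defining product of the cocycle: `∏_{p<i} t(c^p) t(c^{p+j}) = f_t(c^i, c^j)`. -/
theorem prod_mul_shift (t : Cyc n → Cyc 2) (i j : ℕ) :
    ∏ p ∈ Finset.range i, t (gen n ^ p) * t (gen n ^ (p + j)) =
      coc t (gen n ^ i) (gen n ^ j) := by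
  have h : tProd t (i + j) = tProd t j * ∏ p ∈ Finset.range i, t (gen n ^ (p + j)) := by
    rw [add_comm i j, tProd, Finset.prod_range_add]
    simp only [tProd, add_comm j]
  rw [coc_gen_pow, Finset.prod_mul_distrib, h, ← tProd, mul_assoc (tProd t i),
    ← mul_assoc (tProd t j), Sweedler.cyc_two_mul_self, one_mul]

/-- The exponents range over `1, …, n`, so the identity is written as `c^n`. -/
theorem exists_gen_pow [NeZero n] (h : Cyc n) : ∃ i ∈ Finset.Icc 1 n, gen n ^ i = h := by
  refine ⟨expo (h * (gen n)⁻¹) + 1, ?_, ?_⟩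
  · have : expo (h * (gen n)⁻¹) < n := ZMod.val_lt _
    rw [Finset.mem_Icc]
    omega
  · rw [pow_succ, gen_pow_expo, inv_mul_cancel_right]

theorem gen_pow_injOn : Set.InjOn (fun i => gen n ^ i) (Finset.Icc 1 n) := by
  intro i hi j hj h
  simp only [Finset.coe_Icc, Set.mem_Icc] at hi hj
  have h' := congrArg expo h
  simp only [expo_gen_pow] at h'
  rcases hi.2.lt_or_eq with hi' | rfl <;> rcases hj.2.lt_or_eq with hj' | hj'
  · rwa [Nat.mod_eq_of_lt hi', Nat.mod_eq_of_lt hj'] at h'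
  · rw [hj', Nat.mod_self, Nat.mod_eq_of_lt hi'] at h'
    omega
  · rw [Nat.mod_self, Nat.mod_eq_of_lt hj'] at h'
    omega
  · exact hj'.symm

theorem orderOf_gen [NeZero n] : orderOf (gen n) = n := by
  rw [gen, orderOf_ofAdd_eq_addOrderOf, ZMod.addOrderOf_one]

/-- Maps `r : C_n → C_2` and `v : C_n → C_n` that carry the crossed system of `(t, λ)` to the one of
`(t', λ')`: the cocycles of `t` and of `t'` along `v` differ by the coboundary of `r`, and the
actions on `x` differ by the sign by which `r` commutes with `x`. -/
structure Compatible (D D' : CS k n) (r : Cyc n → Cyc 2) (v : Cyc n → Cyc n) : Prop where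
  coc_eq : ∀ h h', coc D.t h h' = r h * r h' * r (h * h') * coc D'.t (v h) (v h')
  weight_eq : ∀ h, (-1 : k) ^ (1 + orderOf (r h)) * weight D h = weight D' (v h)

theorem IsoTriple.compatible [NeZero n] {D D' : CS k n} (T : IsoTriple D D') :
    Compatible D D' T.r (· ^ T.s) where
  coc_eq h h' := by
    obtain ⟨i, hi, rfl⟩ := exists_gen_pow h
    obtain ⟨j, hj, rfl⟩ := exists_gen_pow h'
    have := T.cocycle i hi j hj
    rwa [prod_mul_shift, prod_mul_shift, pow_mul, pow_mul, pow_add] at this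
  weight_eq h := by
    obtain ⟨i, hi, rfl⟩ := exists_gen_pow h
    rw [← pow_mul, weight_gen_pow, weight_gen_pow, ← T.scalar i hi]
    ring

/-- Compatible `r` and `v` come from a triple, whose exponent `s` is determined by `v(c) = c^s`. It
is prime to `n` because `v` preserves the order of `c`. -/
theorem Compatible.exists_isoTriple [NeZero n] {D D' : CS k n} {r : Cyc n → Cyc 2}
    {v : Cyc n →* Cyc n} (hv : Function.Injective v) (hr : r 1 = 1) (H : Compatible D D' r v)
    (β : kˣ) : ∃ T : IsoTriple D D', T.beta = β ∧ T.r = r ∧ ∀ h, h ^ T.s = v h := by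
  obtain ⟨s, hs, hvs⟩ := exists_gen_pow (v (gen n))
  have hvs' : ∀ i, v (gen n ^ i) = gen n ^ (i * s) := fun i => by
    rw [map_pow, ← hvs, ← pow_mul, mul_comm]
  have hcop : Nat.gcd s n = 1 := by
    have h1 : orderOf (gen n ^ s) = n := by rw [hvs, orderOf_injective v hv, orderOf_gen]
    rw [orderOf_pow, orderOf_gen, Nat.gcd_comm] at h1
    have h2 := Nat.div_mul_cancel (Nat.gcd_dvd_right s n)
    rw [h1] at h2
    exact Nat.eq_of_mul_eq_mul_left (NeZero.pos n) (h2.trans (mul_one n).symm)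
  rw [Finset.mem_Icc] at hs
  refine ⟨⟨β, r, s, hr, hs.1, hs.2, hcop, fun i _ j _ => ?_, fun i _ => ?_⟩, rfl, rfl,
    fun h => ?_⟩
  · rw [prod_mul_shift, prod_mul_shift, pow_add, ← hvs', ← hvs', H.coc_eq]
  · rw [← weight_gen_pow D', ← hvs', ← H.weight_eq, weight_gen_pow]
    ring
  · obtain ⟨i, _, rfl⟩ := exists_gen_pow h
    rw [hvs', ← pow_mul]

end Compatible

/-! ### The isomorphism attached to a triple -/

namespace H4n

variable {k : Type*} [Field k] {n : ℕ}

/-- The linear map `a # h ↦ u_β(a) r(h) # v(h)`. -/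
def twist (D D' : CS k n) (β : k) (r : Cyc n → Cyc 2) (v : Cyc n → Cyc n) : H4n D →ₗ[k] H4n D' :=
  extend D fun h => smashLin D' (v h) ∘ₗ LinearMap.mulRight k (Sweedler.grp k (r h)) ∘ₗ
    (Sweedler.scale β).toLinearMap

theorem twist_smash (D D' : CS k n) (β : k) (r : Cyc n → Cyc 2) (v : Cyc n → Cyc n)
    (a : Sweedler k) (h : Cyc n) : twist D D' β r v (smash D a h) =
      smash D' (Sweedler.scale β a * Sweedler.grp k (r h)) (v h) :=
  extend_smash D _ a h

/-- The inverse of `twist` is a `twist`, because `r(h)² = 1`. -/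
theorem twist_twist (D D' : CS k n) (β : kˣ) (r : Cyc n → Cyc 2) (v : Cyc n ≃ Cyc n) (z : H4n D) :
    twist D' D (↑β⁻¹ : k) (r ∘ v.symm) v.symm (twist D D' β r v z) = z := by
  induction z using induction with
  | h0 => simp only [map_zero]
  | hadd z w hz hw => simp only [map_add, hz, hw]
  | hs a h =>
    rw [twist_smash, twist_smash, map_mul, Sweedler.scale_grp, Sweedler.scale_scale, Units.inv_mul,
      Sweedler.scale_one, AlgHom.id_apply, Function.comp_apply, Equiv.symm_apply_apply, mul_assoc,
      Sweedler.grp_mul_self, mul_one]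

theorem twist_bijective (D D' : CS k n) (β : kˣ) (r : Cyc n → Cyc 2) (v : Cyc n ≃ Cyc n) :
    Function.Bijective (twist D D' (β : k) r v) := by
  refine Function.bijective_iff_has_inverse.mpr ⟨_, twist_twist D D' β r v, fun z => ?_⟩
  have := twist_twist D' D β⁻¹ (r ∘ v.symm) v.symm z
  rwa [inv_inv, Equiv.symm_symm, Function.comp_assoc, Equiv.symm_comp_self,
    Function.comp_id] at this

theorem counit_twist (D D' : CS k n) (β : k) (r : Cyc n → Cyc 2) (v : Cyc n → Cyc n) (z : H4n D) :
    Coalgebra.counit (R := k) (twist D D' β r v z) = Coalgebra.counit (R := k) z := by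
  induction z using induction with
  | h0 => simp only [map_zero]
  | hadd z w hz hw => simp only [map_add, hz, hw]
  | hs a h =>
    rw [twist_smash, counit_smash, counit_smash, Bialgebra.counit_mul, Sweedler.counit_grp,
      Sweedler.counit_scale, mul_one]

theorem comul_twist (D D' : CS k n) (β : k) (r : Cyc n → Cyc 2) (v : Cyc n → Cyc n) (z : H4n D) :
    TensorProduct.map (twist D D' β r v) (twist D D' β r v) (Coalgebra.comul (R := k) z) =
      Coalgebra.comul (R := k) (twist D D' β r v z) := by
  induction z using induction with
  | h0 => simp only [map_zero]
  | hadd z w hz hw => simp only [map_add, hz, hw]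
  | hs a h =>
    rw [twist_smash, comul_smash, comul_smash, Bialgebra.comul_mul, Sweedler.comul_grp,
      Sweedler.comul_scale]
    induction Coalgebra.comul (R := k) a using TensorProduct.induction_on with
    | zero => simp only [map_zero, zero_mul]
    | add u w hu hw => simp only [map_add, add_mul, hu, hw]
    | tmul u w =>
      simp only [TensorProduct.map_tmul, Algebra.TensorProduct.map_tmul,
        Algebra.TensorProduct.tmul_mul_tmul, smashLin_apply, twist_smash]

variable [NeZero n]

theorem twist_mul {D D' : CS k n} {r : Cyc n → Cyc 2} {v : Cyc n →* Cyc n}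
    (H : Compatible D D' r v) (β : k) (z w : H4n D) :
    twist D D' β r v (z * w) = twist D D' β r v z * twist D D' β r v w := by
  induction z using induction with
  | h0 => simp only [map_zero, zero_mul]
  | hadd z z' hz hz' => simp only [map_add, add_mul, hz, hz']
  | hs a h =>
    induction w using induction with
    | h0 => simp only [map_zero, mul_zero]
    | hadd z z' hz hz' => simp only [map_add, mul_add, hz, hz']
    | hs b h' =>
      have hc : coc D.t h h' * r (h * h') = r h * r h' * coc D'.t (v h) (v h') := by
        rw [H.coc_eq, mul_right_comm, mul_assoc _ _ (r (h * h')), Sweedler.cyc_two_mul_self, mul_one]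
      simp only [smash_mul_smash, twist_smash, map_mul, act, Sweedler.scale_grp,
        Sweedler.scale_scale, ← H.weight_eq]
      congr 1
      -- moving `r(h)` past `x` produces the sign that `weight_eq` accounts for
      have hm : Sweedler.scale (β * weight D h) b * Sweedler.grp k (r h) =
          Sweedler.grp k (r h) *
            Sweedler.scale ((-1) ^ (1 + orderOf (r h)) * weight D h * β) b := by
        rw [Sweedler.mul_grp, Sweedler.scale_scale, mul_assoc, mul_comm β]
      calc _ = Sweedler.scale β a * (Sweedler.scale (β * weight D h) b *
              Sweedler.grp k (coc D.t h h' * r (h * h'))) := by simp only [map_mul, mul_assoc]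
        _ = Sweedler.scale β a * (Sweedler.scale (β * weight D h) b * Sweedler.grp k (r h)) *
              Sweedler.grp k (r h') * Sweedler.grp k (coc D'.t (v h) (v h')) := by
          simp only [hc, map_mul, mul_assoc]
        _ = _ := by simp only [hm, mul_assoc]

end H4n

namespace IsoTriple

variable {k : Type*} [Field k] {n : ℕ} [NeZero n] {D D' : CS k n}

/-- `ψ_(β, r, s)` as a homomorphism of algebras. -/
def algHom (T : IsoTriple D D') : H4n D →ₐ[k] H4n D' :=
  AlgHom.ofLinearMap (H4n.twist D D' (T.beta : k) T.r (powMonoidHom T.s))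
    (by
      rw [H4n.one_def, H4n.twist_smash, map_one, T.r_one, map_one, mul_one, map_one, H4n.one_def])
    (by
      have H : Compatible D D' T.r (powMonoidHom T.s) := T.compatible
      exact H4n.twist_mul H _)

/-- `ψ_(β, r, s)` as a homomorphism of bialgebras. -/
def bialgHom (T : IsoTriple D D') : H4n D →ₐc[k] H4n D' :=
  BialgHom.ofAlgHom T.algHom (AlgHom.ext (H4n.counit_twist D D' _ _ _))
    (AlgHom.ext (H4n.comul_twist D D' _ _ _))

theorem bialgHom_bijective (T : IsoTriple D D') : Function.Bijective T.bialgHom :=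
  H4n.twist_bijective D D' T.beta T.r
    (powCoprime (n := T.s) (by
      rw [Nat.card_eq_fintype_card, Fintype.card_multiplicative, ZMod.card, Nat.Coprime,
        Nat.gcd_comm, T.gcd_eq]))

/-- The isomorphism `ψ_(β, r, s)`, given by `a # h ↦ u_β(a) r(h) # h^s`. As a bialgebra map between
Hopf algebras it automatically commutes with the antipodes. -/
def bialgEquiv (T : IsoTriple D D') : H4n D ≃ₐc[k] H4n D' :=
  BialgEquiv.ofBijective T.bialgHom T.bialgHom_bijective

theorem bialgEquiv_smash (T : IsoTriple D D') (a : Sweedler k) (h : Cyc n) :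
    T.bialgEquiv (H4n.smash D a h) =
      H4n.smash D' (Sweedler.scale (T.beta : k) a * Sweedler.grp k (T.r h)) (h ^ T.s) :=
  H4n.twist_smash D D' _ _ _ a h

theorem bialgEquiv_injective : Function.Injective (bialgEquiv (D := D) (D' := D')) := by
  intro T T' e
  have key := fun a h => congr($e (H4n.smash D a h))
  simp only [bialgEquiv_smash] at key
  have hr : ∀ h, T.r h = T'.r h ∧ h ^ T.s = h ^ T'.s := fun h => by
    have := key 1 h
    rw [map_one, map_one, one_mul, one_mul] at this
    obtain ⟨h1, h2⟩ := H4n.eq_and_eq_of_smash_eq (Sweedler.grp_ne_zero _) this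
    exact ⟨Sweedler.grp_injective h1, h2⟩
  have hβ : T.beta = T'.beta := by
    have := key (Sweedler.x k) 1
    rw [T.r_one, T'.r_one, map_one, mul_one, mul_one, one_pow, one_pow] at this
    have := congr(QuaternionAlgebra.imJ $(H4n.smash_injective D' 1 this))
    rw [Sweedler.scale_x, Sweedler.scale_x] at this
    simpa [Sweedler.x, Units.val_inj] using this
  have hs : T.s = T'.s := gen_pow_injOn (by simp [T.one_le_s, T.s_le])
    (by simp [T'.one_le_s, T'.s_le]) (hr (gen n)).2
  cases T
  cases T'
  obtain rfl : _ = _ := hβ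
  obtain rfl : _ = _ := hs
  obtain rfl : _ = _ := funext fun h => (hr h).1
  rfl

end IsoTriple

/-! ### The shape of an arbitrary isomorphism -/

section Classification

variable {k : Type*} [Field k] {n : ℕ} [NeZero n] {D D' : CS k n}

namespace H4n

theorem inl_injective (D : CS k n) : Function.Injective (inl D) := smash_injective D 1

theorem inl_mul_smash (D : CS k n) (a b : Sweedler k) (h : Cyc n) :
    inl D a * smash D b h = smash D (a * b) h := smash_one_mul D a b h

theorem isGroupLikeElem_inl_g (D : CS k n) : IsGroupLikeElem k (inl D (Sweedler.g k)) := by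
  rw [← Sweedler.grp_gen]
  exact isGroupLikeElem_smash_grp D _ 1

theorem comul_inl_x (D : CS k n) : Coalgebra.comul (R := k) (inl D (Sweedler.x k)) =
    inl D (Sweedler.x k) ⊗ₜ 1 + inl D (Sweedler.g k) ⊗ₜ inl D (Sweedler.x k) := by
  rw [inl_apply, comul_smash, Sweedler.comul_x]
  rfl

end H4n

theorem comul_apply_inl_x (ψ : H4n D ≃ₐc[k] H4n D') :
    Coalgebra.comul (R := k) (ψ (H4n.inl D (Sweedler.x k))) =
      ψ (H4n.inl D (Sweedler.x k)) ⊗ₜ 1 +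
        ψ (H4n.inl D (Sweedler.g k)) ⊗ₜ ψ (H4n.inl D (Sweedler.x k)) := by
  rw [← CoalgHomClass.map_comp_comul_apply, H4n.comul_inl_x, map_add, TensorProduct.map_tmul,
    TensorProduct.map_tmul]
  simp

/-- A bialgebra isomorphism fixes `g # 1`. Its image is a group-like `γ # h`; if `h ≠ 1`, then the
image of `x # 1` is a multiple of `1 - γ # h`, so `x # 1` is one of `1 - g # 1`, which it is not. -/
theorem apply_inl_g (ψ : H4n D ≃ₐc[k] H4n D') :
    ψ (H4n.inl D (Sweedler.g k)) = H4n.inl D' (Sweedler.g k) := by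
  obtain ⟨γ, h, hG⟩ := H4n.exists_eq_smash_of_isGroupLikeElem
    ((H4n.isGroupLikeElem_inl_g D).map ψ)
  have hy := comul_apply_inl_x ψ
  have hh : h = 1 := by
    by_contra hh
    rw [hG] at hy
    obtain ⟨α, hα⟩ := H4n.eq_smul_one_sub_of_comul_eq hh hy
    rw [← hG, ← map_one ψ, ← map_sub, ← map_smul] at hα
    have := ψ.injective hα
    rw [← map_one (H4n.inl D), ← map_sub, ← map_smul] at this
    have := congr(QuaternionAlgebra.imJ $(H4n.inl_injective D this))
    simp [Sweedler.x, Sweedler.g] at this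
  subst hh
  rcases Sweedler.cyc_two_cases γ with rfl | rfl
  · rw [map_one, ← H4n.one_def, ← map_one ψ, ← map_one (H4n.inl D)] at hG
    have := congr(QuaternionAlgebra.re $(H4n.inl_injective D (ψ.injective hG)))
    simp [Sweedler.g] at this
  · rw [hG, Sweedler.grp_gen, H4n.inl_apply]

/-- A bialgebra isomorphism restricts to some `u_β` on `H_4`. The condition on the characteristic
excludes the images `α (1 - g) + β x` of `x` with `α ≠ 0`, whose square is not zero. -/
theorem exists_apply_inl (hk : ringChar k ≠ 2) (ψ : H4n D ≃ₐc[k] H4n D') :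
    ∃ β : kˣ, ∀ a, ψ (H4n.inl D a) = H4n.inl D' (Sweedler.scale (β : k) a) := by
  have hy := comul_apply_inl_x ψ
  rw [apply_inl_g] at hy
  obtain ⟨α, β, hx⟩ := H4n.eq_smash_of_comul_eq hy
  rw [← H4n.inl_apply] at hx
  have hα : α = 0 := by
    have h0 : H4n.inl D (Sweedler.x k) * H4n.inl D (Sweedler.x k) = 0 := by
      rw [← map_mul, Sweedler.x_mul_x, map_zero]
    have h1 := congr(ψ $h0)
    rw [map_mul, hx, ← map_mul, map_zero, ← map_zero (H4n.inl D')] at h1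
    -- the square of `α (1 - g) + β x` is `2 α² (1 - g) + 2 α β x`
    have h2 := congr(QuaternionAlgebra.re $(H4n.inl_injective D' h1))
    simp [Sweedler.g, Sweedler.x] at h2
    have h3 : (2 : k) * (α * α) = 0 := by linear_combination h2
    simpa [Ring.two_ne_zero hk] using h3
  rw [hα, zero_smul, zero_add] at hx
  have hβ : β ≠ 0 := by
    rintro rfl
    rw [zero_smul, map_zero] at hx
    have h1 := (map_eq_zero_iff ψ ψ.injective).mp hx
    have h2 := (map_eq_zero_iff _ (H4n.inl_injective D)).mp h1
    simpa [Sweedler.x] using congr(QuaternionAlgebra.imJ $h2)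
  refine ⟨Units.mk0 β hβ, fun a => ?_⟩
  have : ((ψ : H4n D →ₐ[k] H4n D').comp (H4n.inl D)) =
      (H4n.inl D').comp (Sweedler.scale (Units.mk0 β hβ : k)) := by
    apply Sweedler.algHom_ext
    · simpa [Sweedler.scale_g] using apply_inl_g ψ
    · simpa [Sweedler.scale_x] using hx
  exact congr($this a)

/-- Every bialgebra isomorphism is of the form `ψ_(β, r, s)`: it restricts to some `u_β` on `H_4`
and maps the group-like elements `1 # h` to elements `r(h) # v(h)`, and compatibility of `r` and
`v` is read off from the images of `(1 # h) (1 # h')` and `(1 # h) (x # 1)`. -/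
theorem IsoTriple.bialgEquiv_surjective (hk : ringChar k ≠ 2) :
    Function.Surjective (IsoTriple.bialgEquiv (D := D) (D' := D')) := by
  intro ψ
  obtain ⟨β, hβ⟩ := exists_apply_inl hk ψ
  have hG : ∀ h, ∃ γ l, ψ (H4n.smash D 1 h) = H4n.smash D' (Sweedler.grp k γ) l := fun h => by
    apply H4n.exists_eq_smash_of_isGroupLikeElem
    simpa using (H4n.isGroupLikeElem_smash_grp D 1 h).map ψ
  choose r v hrv using hG
  have hψ : ∀ a h, ψ (H4n.smash D a h) =
      H4n.smash D' (Sweedler.scale (β : k) a * Sweedler.grp k (r h)) (v h) := fun a h => by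
    rw [← mul_one a, ← H4n.inl_mul_smash, map_mul, hβ, hrv, H4n.inl_mul_smash, mul_one]
  have hone : r 1 = 1 ∧ v 1 = 1 := by
    have h1 := hrv 1
    rw [← H4n.one_def, map_one, H4n.one_def, ← map_one (Sweedler.grp k)] at h1
    obtain ⟨h2, h3⟩ := H4n.eq_and_eq_of_smash_eq (Sweedler.grp_ne_zero _) h1
    exact ⟨(Sweedler.grp_injective h2).symm, h3.symm⟩
  have hmul : ∀ h h', r h * r h' * coc D'.t (v h) (v h') = coc D.t h h' * r (h * h') ∧
      v h * v h' = v (h * h') := fun h h' => by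
    have h1 := map_mul ψ (H4n.smash D 1 h) (H4n.smash D 1 h')
    rw [H4n.smash_mul_smash, hψ, hrv, hrv, H4n.smash_mul_smash, map_one, mul_one, one_mul, act,
      Sweedler.scale_grp, Sweedler.scale_grp, ← map_mul, ← map_mul, ← map_mul] at h1
    obtain ⟨h2, h3⟩ := H4n.eq_and_eq_of_smash_eq (Sweedler.grp_ne_zero _) h1
    exact ⟨(Sweedler.grp_injective h2).symm, h3.symm⟩
  let w : Cyc n →* Cyc n := ⟨⟨v, hone.2⟩, fun h h' => (hmul h h').2.symm⟩
  have hw : Function.Injective w := by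
    refine (injective_iff_map_eq_one w).mpr fun h (hh : v h = 1) => ?_
    -- both `1 # h` and `r(h) # 1` are mapped to `r(h) # 1`
    have h1 : ψ (H4n.smash D 1 h) = ψ (H4n.smash D (Sweedler.grp k (r h)) 1) := by
      rw [hrv, hψ, hone.1, hone.2, hh, Sweedler.scale_grp, map_one, mul_one]
    exact (H4n.eq_and_eq_of_smash_eq one_ne_zero (ψ.injective h1)).2
  have hweight : ∀ h, (-1 : k) ^ (1 + orderOf (r h)) * weight D h = weight D' (v h) := fun h => by
    have h1 := map_mul ψ (H4n.smash D 1 h) (H4n.smash D (Sweedler.x k) 1)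
    rw [H4n.smash_mul_smash, hψ, hψ, hψ, H4n.smash_mul_smash, coc_one_right, hone.1, hone.2,
      coc_one_right] at h1
    simp only [map_one, mul_one, one_mul, act, Sweedler.scale_scale] at h1
    rw [Sweedler.mul_grp, Sweedler.scale_scale] at h1
    -- cancel `r(h)` on the left, then compare the coefficients of `x`
    have h2 := congr(Sweedler.grp k (r h) * $(H4n.smash_injective D' _ h1))
    simp only [← mul_assoc, Sweedler.grp_mul_self, one_mul, Sweedler.scale_x] at h2
    have h3 := congr(QuaternionAlgebra.imJ $h2)
    simp only [Sweedler.x, QuaternionAlgebra.imJ_smul, smul_eq_mul, mul_one] at h3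
    exact mul_right_cancel₀ β.ne_zero (by linear_combination h3)
  have H : Compatible D D' r w := by
    refine ⟨fun h h' => ?_, hweight⟩
    have h1 := (hmul h h').1
    rw [← mul_right_cancel_iff (a := r (h * h')), mul_assoc (coc D.t h h'),
      Sweedler.cyc_two_mul_self, mul_one] at h1
    rw [← h1, mul_right_comm]
    rfl
  obtain ⟨T, rfl, rfl, hT⟩ := H.exists_isoTriple hw hone.1 β
  refine ⟨T, DFunLike.ext _ _ fun z => ?_⟩
  induction z using H4n.induction with
  | h0 => rw [map_zero, map_zero]
  | hadd z z' hz hz' => rw [map_add, map_add, hz, hz']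
  | hs a h =>
    rw [T.bialgEquiv_smash, hψ, hT]
    rfl

end Classification

end CrossedSweedler

end

theorem theorem3p4 {k : Type*} [Field k] (hk : ringChar k ≠ 2) (n : ℕ) [NeZero n]
    (D D' : CrossedSweedler.CS k n) :
    ∃ Φ : CrossedSweedler.IsoTriple D D' ≃
        (CrossedSweedler.H4n D ≃ₐc[k] CrossedSweedler.H4n D'),
      ∀ (T : CrossedSweedler.IsoTriple D D') (a : CrossedSweedler.Sweedler k),
        ∀ i ∈ Finset.Icc 1 n,
          Φ T (CrossedSweedler.H4n.smash D a (CrossedSweedler.gen n ^ i)) =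
            CrossedSweedler.H4n.smash D'
              (CrossedSweedler.Sweedler.scale (T.beta : k) a *
                CrossedSweedler.Sweedler.grp k (T.r (CrossedSweedler.gen n ^ i)))
              (CrossedSweedler.gen n ^ (i * T.s)) := by
  refine ⟨Equiv.ofBijective CrossedSweedler.IsoTriple.bialgEquiv
    ⟨CrossedSweedler.IsoTriple.bialgEquiv_injective,
      CrossedSweedler.IsoTriple.bialgEquiv_surjective hk⟩, fun T a i _ => ?_⟩
  rw [pow_mul]
  exact T.bialgEquiv_smash a _
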